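/- For permutations $p=p_1\cdots p_n$ of $\{1,\dots,n\}$ and $q=q_1\cdots q_k$ of $\{1,\dots,k\}$, let $f_q(p)$ be the number of occurrences of $q$ in $p$ as a pattern, i.e. the number of sequences of positions $1\le i_1<\dots<i_k\le n$ such that $p_{i_r}<p_{i_s}$ if and only if $q_r<q_s$. Let $\mathrm{Av}_n(123)$ be the set of permutations $p$ of $\{1,\dots,n\}$ with $f_{123}(p)=0$, and let $$a_n=\sum_{p\in \mathrm{Av}_n(123)}f_{132}(p),\qquad b_n=\sum_{p\in \mathrm{Av}_n(123)}f_{231}(p),\qquad d_n=\sum_{p\in \mathrm{Av}_n(123)}f_{321}(p).$$ Then, with the convention $\binom{m}{k}=0$ for $k<0$: - for all $n\ge 1$, $$a_n=\frac{n+2}{4}\binom{2n}{n}-3\cdot 2^{2n-3};$$ - for all $n\ge 2$, $$b_n=(2n-1)\binom{2n-3}{n-2}-(2n+1)\binom{2n-1}{n-1}+(n+4)\cdot 2^{2n-3};$$ - for all $n\ge 1$, $$d_n=\frac16\binom{2n+5}{n+1}\binom{n+4}{2}-\frac53\binom{2n+3}{n}\binom{n+3}{2}+\frac{17}{3}\binom{2n+1}{n-1}\binom{n+2}{2}-6\binom{2n-1}{n-2}\binom{n+1}{2}-(n+1)\cdot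 4^{n-1}.$$ -/

import Mathlib

namespace PatternTotals

/-- The occurrences of the pattern `q` in the permutation `p` of `{0, …, n - 1}`: the increasing
sequences of positions `s 0 < ⋯ < s (k - 1)` such that the entries of `p` at these positions are
in the same relative order as the entries of `q`. -/
def occurrences {k n : ℕ} (q : Equiv.Perm (Fin k)) (p : Equiv.Perm (Fin n)) :
    Finset (Fin k → Fin n) :=
  {s | (∀ i j, i < j → s i < s j) ∧ ∀ i j, p (s i) < p (s j) ↔ q i < q j}

/-- The number `f_q(p)` of occurrences of `q` in `p` as a pattern. -/
def patternCount {k n : ℕ} (q : Equiv.Perm (Fin k)) (p : Equiv.Perm (Fin n)) : ℕ :=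
  (occurrences q p).card

/-- The set `Av_n(q)` of the permutations of length `n` that contain no occurrence of `q`. -/
def Av (n : ℕ) {k : ℕ} (q : Equiv.Perm (Fin k)) : Finset (Equiv.Perm (Fin n)) :=
  {p | occurrences q p = ∅}

/-- The total number `f_q(C)` of occurrences of `q` in the members of `C`. -/
def patternTotal {k n : ℕ} (q : Equiv.Perm (Fin k)) (C : Finset (Equiv.Perm (Fin n))) : ℕ :=
  ∑ p ∈ C, patternCount q p

/-- The pattern 123; one-line notation is shifted to the values `0, 1, 2`. -/
def p123 : Equiv.Perm (Fin 3) := ⟨![0, 1, 2], ![0, 1, 2], by decide, by decide⟩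

/-- The pattern 132. -/
def p132 : Equiv.Perm (Fin 3) := ⟨![0, 2, 1], ![0, 2, 1], by decide, by decide⟩

/-- The pattern 231. -/
def p231 : Equiv.Perm (Fin 3) := ⟨![1, 2, 0], ![2, 0, 1], by decide, by decide⟩

/-- The pattern 321. -/
def p321 : Equiv.Perm (Fin 3) := ⟨![2, 1, 0], ![2, 1, 0], by decide, by decide⟩

/-- The binomial coefficient with an integer lower index, zero if that index is negative. -/
def binom (m : ℕ) (k : ℤ) : ℚ := if 0 ≤ k then (m.choose k.toNat : ℚ) else 0

end PatternTotals

/-! Every 123-avoiding permutation arises from the empty one by repeatedly prepending an entry. An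
entry with `t` larger ones can be prepended if and only if the `t` largest entries are in decreasing
order, which gives a recurrence in `t` for generating functions over the length. Pairing it with the
powers of the Catalan series `C` makes it telescope, and shows that the entries with `t ≠ 0` larger
ones to their right have generating function `(C - 1) ^ (t + 1)`.

Both `f₁₂` and `f₁₂₃ + f₁₃₂` depend only on these numbers `t` of larger entries to the right: they
are the sums of `t` and of `t.choose 2` over all entries. Their totals thus become explicit in terms
of `1 / √(1 - 4 X)`, and the second one is the total of `f₁₃₂`. Counting the occurrences of `12`
inside the occurrences of patterns of length three, and using that reverse-complementation preserves
123-avoidance and exchanges `132` with `213` and `231` with `312`, one obtains the total of `f₂₃₁`.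
Finally the totals of all six patterns add up to `n.choose 3 * catalan n`. -/

namespace PatternTotals

open Finset

section CatalanSeries

open PowerSeries

variable {R : Type*} [CommRing R]

variable (R) in
/-- The Catalan series `∑ catalan n * X ^ n` with coefficients in `R`. -/
noncomputable def castCatalanSeries : R⟦X⟧ := catalanSeries.map (Nat.castRingHom R)

variable (R) in
/-- The generating function `∑ n.centralBinom * X ^ n` of the central binomial coefficients. -/
noncomputable def centralBinomSeries : R⟦X⟧ := PowerSeries.mk fun n => (n.centralBinom : R)

@[simp]
lemma coeff_castCatalanSeries (n : ℕ) : coeff n (castCatalanSeries R) = catalan n := by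
  simp [castCatalanSeries]

@[simp]
lemma coeff_centralBinomSeries (n : ℕ) : coeff n (centralBinomSeries R) = n.centralBinom := by
  simp [centralBinomSeries]

@[simp]
lemma constantCoeff_centralBinomSeries : constantCoeff (centralBinomSeries R) = 1 := by
  rw [← coeff_zero_eq_constantCoeff_apply, coeff_centralBinomSeries, Nat.centralBinom_zero,
    Nat.cast_one]

lemma castCatalanSeries_eq_one_add :
    castCatalanSeries R = 1 + X * castCatalanSeries R ^ 2 := by
  have h := congrArg (PowerSeries.map (Nat.castRingHom R)) catalanSeries_sq_mul_X_add_one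
  simp only [map_add, map_mul, map_pow, map_one, PowerSeries.map_X] at h
  rw [castCatalanSeries]
  linear_combination -h

lemma derivative_X_mul_castCatalanSeries :
    d⁄dX R (X * castCatalanSeries R) = centralBinomSeries R := by
  ext n
  rw [coeff_derivative, coeff_succ_X_mul, coeff_castCatalanSeries, coeff_centralBinomSeries,
    ← succ_mul_catalan_eq_centralBinom]
  push_cast
  ring

lemma centralBinomSeries_mul_one_sub :
    centralBinomSeries R * (1 - 2 * (X * castCatalanSeries R)) = 1 := by
  have hsq : X * castCatalanSeries R * (X * castCatalanSeries R) = X * castCatalanSeries R - X := by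
    linear_combination -X * castCatalanSeries_eq_one_add (R := R)
  have h := congrArg (d⁄dX R) hsq
  rw [map_sub, Derivation.leibniz, derivative_X_mul_castCatalanSeries, derivative_X] at h
  simp only [smul_eq_mul] at h
  linear_combination -h

lemma centralBinomSeries_sq_mul : centralBinomSeries R ^ 2 * (1 - 4 * X) = 1 := by
  linear_combination
    (centralBinomSeries R * (1 - 2 * (X * castCatalanSeries R)) + 1) *
      centralBinomSeries_mul_one_sub (R := R) +
    4 * centralBinomSeries R ^ 2 * X * castCatalanSeries_eq_one_add (R := R)

lemma coeff_succ_eq_of_mul_one_sub_C_mul_X {a : R} {F G : R⟦X⟧} (h : F * (1 - C a * X) = G)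
    (n : ℕ) : coeff (n + 1) F = a * coeff n F + coeff (n + 1) G := by
  rw [← h, show F * (1 - C a * X) = F - C a * (F * X) by ring, map_sub, coeff_C_mul,
    coeff_succ_mul_X]
  ring

lemma coeff_centralBinomSeries_sq (n : ℕ) : coeff n (centralBinomSeries R ^ 2) = (4 ^ n : R) := by
  induction n with
  | zero => simp
  | succ n ih =>
    have h : centralBinomSeries R ^ 2 * (1 - C (4 : R) * X) = 1 := by
      rw [map_ofNat, centralBinomSeries_sq_mul]
    rw [coeff_succ_eq_of_mul_one_sub_C_mul_X h, ih, coeff_one, if_neg n.succ_ne_zero]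
    ring

lemma coeff_centralBinomSeries_cube (n : ℕ) :
    coeff n (centralBinomSeries R ^ 3) = ((2 * n + 1) * n.centralBinom : R) := by
  induction n with
  | zero => simp
  | succ n ih =>
    have h : centralBinomSeries R ^ 3 * (1 - C (4 : R) * X) = centralBinomSeries R := by
      rw [map_ofNat]
      linear_combination centralBinomSeries R * centralBinomSeries_sq_mul (R := R)
    have hsucc := congrArg (Nat.cast (R := R)) n.succ_mul_centralBinom_succ
    rw [coeff_succ_eq_of_mul_one_sub_C_mul_X h, ih, coeff_centralBinomSeries]
    push_cast at hsucc ⊢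
    linear_combination -2 * hsucc

lemma mk_choose_mul_one_sub_X_pow (m : ℕ) :
    (PowerSeries.mk fun t => (t.choose m : R)) * (1 - X) ^ (m + 1) = X ^ m := by
  have h : (PowerSeries.mk fun t => (t.choose m : R)) =
      X ^ m * PowerSeries.mk fun t => ((m + t).choose m : R) := by
    ext t
    rw [coeff_X_pow_mul', coeff_mk]
    split_ifs with hmt
    · rw [coeff_mk, Nat.add_sub_cancel' hmt]
    · rw [Nat.choose_eq_zero_of_lt (not_le.mp hmt), Nat.cast_zero]
  rw [h, mul_assoc, mk_add_choose_mul_one_sub_pow_eq_one, mul_one]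

lemma hasSubst_X_mul (f : R⟦X⟧) : HasSubst (X * f) :=
  HasSubst.of_constantCoeff_zero' (by simp)

lemma pow_dvd_subst_sub_sum_range {y : R⟦X⟧} (hy : HasSubst y) (f : R⟦X⟧) (N : ℕ) :
    y ^ N ∣ f.subst y - ∑ t ∈ range N, coeff t f • y ^ t := by
  have h : X ^ N ∣ f - ∑ t ∈ range N, coeff t f • (X : R⟦X⟧) ^ t := by
    refine X_pow_dvd_iff.mpr fun n hn => ?_
    simp [coeff_X_pow, hn]
  simpa only [map_sub, map_sum, map_smul, map_pow, coe_substAlgHom hy, subst_X hy] using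
    map_dvd (substAlgHom hy) h

/-- Both sides are `((1 / √(1 - 4 X) - 1) / 2) ^ (m + 1)`. -/
lemma mul_subst_mk_choose (m : ℕ) :
    X * castCatalanSeries R ^ 2 *
        (PowerSeries.mk fun t => (t.choose m : R)).subst (X * castCatalanSeries R ^ 2) =
      (X * castCatalanSeries R * centralBinomSeries R) ^ (m + 1) := by
  set y : R⟦X⟧ := X * castCatalanSeries R ^ 2 with hy
  have hs : HasSubst y := hasSubst_X_mul _
  have hsubst := congrArg (PowerSeries.subst y) (mk_choose_mul_one_sub_X_pow (R := R) m)
  rw [subst_mul hs, subst_pow hs, subst_pow hs, subst_sub hs, subst_X hs,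
    ← coe_substAlgHom hs, map_one, coe_substAlgHom hs] at hsubst
  have hz : X * castCatalanSeries R * centralBinomSeries R * (1 - y) = y := by
    rw [hy]
    linear_combination
      X * castCatalanSeries R ^ 2 * centralBinomSeries_mul_one_sub (R := R) -
        X * castCatalanSeries R * centralBinomSeries R * castCatalanSeries_eq_one_add (R := R)
  have hunit : IsUnit ((1 - y) ^ (m + 1)) := by
    refine IsUnit.pow _ (isUnit_iff_constantCoeff.mpr ?_)
    simp [hy]
  refine hunit.mul_right_cancel ?_
  rw [← mul_pow, hz, mul_assoc, hsubst, ← pow_succ']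

/-- Pairing with `C ^ (t + 2)`, which solves the adjoint recurrence because `C = 1 + X * C ^ 2`,
makes everything telescope except for the initial term. -/
lemma sum_range_castCatalanSeries_pow_mul {K : ℕ → R⟦X⟧} (h0 : K 0 = K 1) (N : ℕ) :
    ∑ t ∈ range N, castCatalanSeries R ^ (t + 2) * (K (t + 1) - K (t + 2) - X * K t) =
      K 0 - castCatalanSeries R ^ (N + 1) * K (N + 1) +
        X * castCatalanSeries R ^ (N + 2) * K N := by
  induction N with
  | zero =>
    rw [sum_range_zero]
    linear_combination -castCatalanSeries R * h0 + K 0 * castCatalanSeries_eq_one_add (R := R)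
  | succ N ih =>
    rw [sum_range_succ, ih]
    linear_combination castCatalanSeries R ^ (N + 1) * K (N + 1) *
      castCatalanSeries_eq_one_add (R := R)

lemma X_pow_dvd_sub_sum_range {K : ℕ → R⟦X⟧} (h0 : K 0 = K 1) (hdvd : ∀ t, X ^ t ∣ K t) (N : ℕ) :
    X ^ N ∣ K 0 - ∑ t ∈ range N,
      castCatalanSeries R ^ (t + 2) * (K (t + 1) - K (t + 2) - X * K t) := by
  rw [sum_range_castCatalanSeries_pow_mul h0]
  have h : X ^ N ∣ K (N + 1) := (pow_dvd_pow X N.le_succ).trans (hdvd _)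
  convert (h.mul_left (castCatalanSeries R ^ (N + 1))).sub
    ((hdvd N).mul_left (X * castCatalanSeries R ^ (N + 2))) using 1
  ring

lemma eq_zero_of_forall_X_pow_dvd {f : R⟦X⟧} (h : ∀ N, X ^ N ∣ f) : f = 0 := by
  ext n
  exact X_pow_dvd_iff.mp (h (n + 1)) n n.lt_succ_self

lemma eq_zero_of_recurrence {K : ℕ → R⟦X⟧} (h0 : K 0 = K 1) (hdvd : ∀ t, X ^ t ∣ K t)
    (hrec : ∀ t, K (t + 1) = K (t + 2) + X * K t) (t : ℕ) : K t = 0 := by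
  have hres (t : ℕ) : K (t + 1) - K (t + 2) - X * K t = 0 := by rw [hrec]; ring
  have hzero : K 0 = 0 := eq_zero_of_forall_X_pow_dvd fun N => by
    simpa only [hres, mul_zero, sum_const_zero, sub_zero] using X_pow_dvd_sub_sum_range h0 hdvd N
  induction t using Nat.twoStepInduction with
  | zero => exact hzero
  | one => exact h0 ▸ hzero
  | more t ht ht' => linear_combination -hrec t + ht' - X * ht

end CatalanSeries

section Patterns

variable {k m n : ℕ}

/-- The finite set of strictly increasing sequences of length `k` in `α`. -/
def increasingSeqs (k : ℕ) (α : Type*) [LinearOrder α] [Fintype α] : Finset (Fin k → α) :=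
  {s | ∀ i j, i < j → s i < s j}

@[simp]
lemma mem_increasingSeqs {α : Type*} [LinearOrder α] [Fintype α] {s : Fin k → α} :
    s ∈ increasingSeqs k α ↔ StrictMono s := by
  simp [increasingSeqs, StrictMono]

lemma card_increasingSeqs_filter_image {α : Type*} [LinearOrder α] [Fintype α]
    (P : Finset α → Prop) [DecidablePred P] :
    #{s ∈ increasingSeqs k α | P (univ.image s)} = #{S ∈ powersetCard k univ | P S} := by
  refine card_bij (fun s _ => univ.image s) ?_ ?_ ?_
  · intro s hs
    simp only [mem_filter, mem_increasingSeqs] at hs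
    simpa [hs.2] using card_image_of_injective univ hs.1.injective
  · intro s hs s' hs' h
    simp only [mem_filter, mem_increasingSeqs] at hs hs'
    exact (hs.1.range_inj hs'.1).mp (by simpa using congrArg (SetLike.coe) h)
  · intro S hS
    simp only [mem_filter, mem_powersetCard_univ] at hS
    have himage : univ.image (S.orderEmbOfFin hS.1) = S := S.image_orderEmbOfFin_univ hS.1
    exact ⟨S.orderEmbOfFin hS.1, by simp [himage, hS.2, OrderEmbedding.strictMono], himage⟩

lemma card_increasingSeqs_filter_image_subset {α : Type*} [LinearOrder α] [Fintype α]
    (U : Finset α) : #{s ∈ increasingSeqs k α | univ.image s ⊆ U} = (#U).choose k := by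
  rw [card_increasingSeqs_filter_image (· ⊆ U), ← card_powersetCard]
  congr 1
  ext S
  simp [mem_powersetCard, and_comm]

lemma card_increasingSeqs_filter_subset_image {α : Type*} [LinearOrder α] [Fintype α]
    {U : Finset α} (hU : #U ≤ k) :
    #{s ∈ increasingSeqs k α | U ⊆ univ.image s} =
      (Fintype.card α - #U).choose (k - #U) := by
  rw [card_increasingSeqs_filter_image (U ⊆ ·), ← card_compl, ← card_powersetCard]
  refine card_nbij' (· \ U) (· ∪ U) ?_ ?_ ?_ ?_
  · intro S hS
    simp only [coe_filter, mem_powersetCard_univ, Set.mem_ofPred_eq] at hS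
    simp [mem_powersetCard, card_sdiff_of_subset hS.2, hS.1]
  · intro S hS
    obtain ⟨hSU, hcard⟩ := mem_powersetCard.mp (mem_coe.mp hS)
    have hdisj : Disjoint S U := le_compl_iff_disjoint_right.mp hSU
    simp [card_union_of_disjoint hdisj, hcard, Nat.sub_add_cancel hU]
  · intro S hS
    simp only [coe_filter, mem_powersetCard_univ, Set.mem_ofPred_eq] at hS
    exact sdiff_union_of_subset hS.2
  · intro S hS
    obtain ⟨hSU, -⟩ := mem_powersetCard.mp (mem_coe.mp hS)
    exact union_sdiff_cancel_right (le_compl_iff_disjoint_right.mp hSU)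

lemma mem_occurrences {q : Equiv.Perm (Fin k)} {p : Equiv.Perm (Fin n)} {s : Fin k → Fin n} :
    s ∈ occurrences q p ↔ StrictMono s ∧ ∀ i j, p (s i) < p (s j) ↔ q i < q j := by
  simp [occurrences, StrictMono]

lemma existsUnique_perm_lt_iff_lt {α : Type*} [LinearOrder α] {f : Fin k → α}
    (hf : Function.Injective f) : ∃! q : Equiv.Perm (Fin k), ∀ i j, f i < f j ↔ q i < q j := by
  have hmono : StrictMono (f ∘ Tuple.sort f) :=
    (Tuple.monotone_sort f).strictMono_of_injective (hf.comp (Tuple.sort f).injective)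
  refine ⟨(Tuple.sort f)⁻¹, fun i j => ?_, fun q hq => ?_⟩
  · simpa using hmono.lt_iff_lt (a := (Tuple.sort f)⁻¹ i) (b := (Tuple.sort f)⁻¹ j)
  · have hq' : StrictMono (f ∘ q.symm) := fun i j hij => by
      rw [Function.comp_apply, Function.comp_apply, hq]
      simpa using hij
    have hrange : Set.range (f ∘ q.symm) = Set.range (f ∘ Tuple.sort f) := by
      simp only [EquivLike.range_comp]
    have hcomp := hf.comp_left ((hq'.range_inj hmono).mp hrange)
    rw [← DFunLike.coe_injective hcomp]
    rfl

lemma sum_sum_occurrences {M : Type*} [AddCommMonoid M] (p : Equiv.Perm (Fin n))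
    (g : (Fin k → Fin n) → M) :
    ∑ q : Equiv.Perm (Fin k), ∑ s ∈ occurrences q p, g s = ∑ s ∈ increasingSeqs k (Fin n), g s := by
  rw [← sum_biUnion]
  · congr 1
    ext s
    simp only [mem_biUnion, mem_univ, true_and, mem_occurrences, mem_increasingSeqs,
      exists_and_left]
    exact and_iff_left_of_imp fun hs =>
      (existsUnique_perm_lt_iff_lt (p.injective.comp hs.injective)).exists
  · intro q _ q' _ hne
    refine disjoint_left.mpr fun s hs hs' => hne ?_
    rw [mem_occurrences] at hs hs'
    exact (existsUnique_perm_lt_iff_lt (p.injective.comp hs.1.injective)).unique hs.2 hs'.2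

lemma patternCount_eq_card_filter_of_mem_occurrences {r : Equiv.Perm (Fin m)}
    {q : Equiv.Perm (Fin k)} {p : Equiv.Perm (Fin n)} {s : Fin k → Fin n}
    (hs : s ∈ occurrences q p) :
    patternCount r q = #{u ∈ occurrences r p | univ.image u ⊆ univ.image s} := by
  rw [mem_occurrences] at hs
  refine card_bij (fun v _ => s ∘ v) ?_ ?_ ?_
  · intro v hv
    rw [mem_occurrences] at hv
    rw [mem_filter, mem_occurrences]
    refine ⟨⟨hs.1.comp hv.1, fun i j => (hs.2 _ _).trans (hv.2 i j)⟩, ?_⟩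
    rw [← image_image]
    exact image_subset_image (subset_univ _)
  · intro v _ v' _ h
    exact hs.1.injective.comp_left h
  · intro u hu
    rw [mem_filter, mem_occurrences] at hu
    have hfactor (i : Fin m) : ∃ j, s j = u i := by
      simpa using hu.2 (mem_image_of_mem u (mem_univ i))
    choose v hv using hfactor
    obtain rfl : s ∘ v = u := funext hv
    exact ⟨v, mem_occurrences.mpr ⟨fun i j hij => hs.1.lt_iff_lt.mp (hu.1.1 hij),
      fun i j => (hs.2 _ _).symm.trans (hu.1.2 i j)⟩, rfl⟩

lemma sum_patternCount_mul_patternCount (hmk : m ≤ k) (r : Equiv.Perm (Fin m))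
    (p : Equiv.Perm (Fin n)) :
    ∑ q : Equiv.Perm (Fin k), patternCount r q * patternCount q p =
      (n - m).choose (k - m) * patternCount r p := by
  calc
    _ = ∑ q : Equiv.Perm (Fin k), ∑ s ∈ occurrences q p,
          #{u ∈ occurrences r p | univ.image u ⊆ univ.image s} := by
      refine sum_congr rfl fun q _ => ?_
      rw [← sum_congr rfl fun s hs => patternCount_eq_card_filter_of_mem_occurrences hs,
        sum_const, smul_eq_mul, mul_comm, patternCount]
    _ = ∑ u ∈ occurrences r p, #{s ∈ increasingSeqs k (Fin n) | univ.image u ⊆ univ.image s} := by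
      rw [sum_sum_occurrences]
      exact sum_card_bipartiteAbove_eq_sum_card_bipartiteBelow
        fun s u => univ.image u ⊆ univ.image s
    _ = ∑ _ ∈ occurrences r p, (n - m).choose (k - m) := by
      refine sum_congr rfl fun u hu => ?_
      have hcard : #(univ.image u) = m := by
        rw [card_image_of_injective _ (mem_occurrences.mp hu).1.injective, card_fin]
      rw [card_increasingSeqs_filter_subset_image (hcard.trans_le hmk), hcard, Fintype.card_fin]
    _ = _ := by rw [sum_const, smul_eq_mul, mul_comm, patternCount]

lemma sum_patternCount (k : ℕ) (p : Equiv.Perm (Fin n)) :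
    ∑ q : Equiv.Perm (Fin k), patternCount q p = n.choose k := by
  have hempty {l : ℕ} (q : Equiv.Perm (Fin l)) : patternCount (1 : Equiv.Perm (Fin 0)) q = 1 :=
    card_eq_one.mpr ⟨Fin.elim0, by
      ext s
      simp [mem_occurrences, StrictMono, eq_iff_true_of_subsingleton]⟩
  simpa only [hempty, one_mul, mul_one, Nat.sub_zero] using
    sum_patternCount_mul_patternCount k.zero_le 1 p

/-- The number of entries to the right of position `i` that are larger than the entry at `i`. -/
def upCount (p : Equiv.Perm (Fin n)) (i : Fin n) : ℕ :=
  #{j | i < j ∧ p i < p j}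

/-- The sum over all entries of a weight depending on the number of larger entries to the
right. -/
def upSum {M : Type*} [AddCommMonoid M] (w : ℕ → M) (p : Equiv.Perm (Fin n)) : M :=
  ∑ i, w (upCount p i)

lemma card_increasingSeqs_filter_min_zero (p : Equiv.Perm (Fin n)) :
    #{s ∈ increasingSeqs (m + 1) (Fin n) | ∀ j : Fin m, p (s 0) < p (s j.succ)} =
      upSum (fun t => t.choose m) p := by
  simp only [upSum, upCount, ← card_increasingSeqs_filter_image_subset, ← card_sigma]
  refine (card_nbij' (fun x => Fin.cons x.1 x.2) (fun s => ⟨s 0, Fin.tail s⟩) ?_ ?_ ?_ ?_).symm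
  · rintro ⟨i, s⟩ hs
    simp_all [StrictMono, Fin.forall_fin_succ, image_subset_iff]
  · intro s hs
    simp_all [StrictMono, Fin.forall_fin_succ, image_subset_iff, Fin.tail]
  · rintro ⟨i, s⟩ -
    simp
  · intro s _
    simp

lemma sum_patternCount_filter_zero (p : Equiv.Perm (Fin n)) :
    ∑ q : Equiv.Perm (Fin (m + 1)) with q 0 = 0, patternCount q p =
      upSum (fun t => t.choose m) p := by
  rw [← card_increasingSeqs_filter_min_zero, card_filter, ← sum_sum_occurrences p, sum_filter]
  refine sum_congr rfl fun q _ => ?_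
  have hmin {s : Fin (m + 1) → Fin n} (hs : s ∈ occurrences q p) :
      (∀ j : Fin m, p (s 0) < p (s j.succ)) ↔ q 0 = 0 := by
    simp only [(mem_occurrences.mp hs).2]
    constructor
    · intro h
      obtain ⟨i, hi⟩ := q.surjective 0
      cases i using Fin.cases with
      | zero => exact hi
      | succ j => exact absurd (hi ▸ h j) (Fin.not_lt_zero _)
    · intro h j
      rw [h, Fin.pos_iff_ne_zero, ← h]
      exact q.injective.ne (Fin.succ_ne_zero j)
  rw [sum_congr rfl fun s hs => if_congr (hmin hs) rfl rfl]
  split_ifs <;> simp [patternCount]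

/-- The reverse-complement of a permutation. -/
def revComp (p : Equiv.Perm (Fin n)) : Equiv.Perm (Fin n) :=
  Fin.revPerm * p * Fin.revPerm

lemma revComp_apply (p : Equiv.Perm (Fin n)) (i : Fin n) : revComp p i = (p i.rev).rev := rfl

lemma revComp_revComp (p : Equiv.Perm (Fin n)) : revComp (revComp p) = p := by
  ext i
  simp [revComp_apply]

lemma patternCount_revComp (q : Equiv.Perm (Fin k)) (p : Equiv.Perm (Fin n)) :
    patternCount (revComp q) (revComp p) = patternCount q p := by
  refine card_equiv (Equiv.arrowCongr Fin.revPerm Fin.revPerm) fun s => ?_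
  have hswap (P : Fin k → Fin k → Prop) : (∀ i j, P i j) ↔ ∀ i j : Fin k, P j.rev i.rev :=
    ⟨fun h i j => h _ _, fun h i j => by simpa using h j.rev i.rev⟩
  simp only [mem_occurrences, StrictMono, revComp_apply, Fin.rev_lt_rev]
  refine and_congr ((hswap _).trans ?_) ((hswap _).trans ?_) <;> simp

lemma revComp_mem_Av {q : Equiv.Perm (Fin k)} {p : Equiv.Perm (Fin n)} :
    revComp p ∈ Av n (revComp q) ↔ p ∈ Av n q := by
  simp only [Av, mem_filter, mem_univ, true_and, ← card_eq_zero]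
  exact (patternCount_revComp q p).congr_left

lemma patternTotal_revComp (q : Equiv.Perm (Fin k)) (r : Equiv.Perm (Fin m)) :
    patternTotal (revComp q) (Av n (revComp r)) = patternTotal q (Av n r) := by
  refine sum_nbij' revComp revComp (fun p hp => ?_) (fun p hp => revComp_mem_Av.mpr hp)
    (fun p _ => revComp_revComp p) (fun p _ => revComp_revComp p) fun p _ => ?_
  · rwa [← revComp_mem_Av, revComp_revComp]
  · rw [← patternCount_revComp, revComp_revComp]

lemma patternCount_p123_add_p132 (p : Equiv.Perm (Fin n)) :
    patternCount p123 p + patternCount p132 p = upSum (fun t => t.choose 2) p := by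
  have hfilter : ({q | q 0 = 0} : Finset (Equiv.Perm (Fin 3))) = {p123, p132} := by decide
  rw [← sum_patternCount_filter_zero, hfilter, sum_pair (by decide)]

lemma patternCount_one (p : Equiv.Perm (Fin n)) :
    patternCount (1 : Equiv.Perm (Fin 2)) p = upSum (fun t => t.choose 1) p := by
  have hfilter : ({q | q 0 = 0} : Finset (Equiv.Perm (Fin 2))) = {1} := by decide
  rw [← sum_patternCount_filter_zero, hfilter, sum_singleton]

lemma sum_perm_fin_three {M : Type*} [AddCommMonoid M] (f : Equiv.Perm (Fin 3) → M) :
    ∑ q, f q = f p123 + f p132 + f (revComp p132) + f p231 + f (revComp p231) + f p321 := by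
  have huniv : (univ : Finset (Equiv.Perm (Fin 3))) =
      {p123, p132, revComp p132, p231, revComp p231, p321} := by decide
  rw [huniv, sum_insert (by decide), sum_insert (by decide), sum_insert (by decide),
    sum_insert (by decide), sum_insert (by decide), sum_singleton]
  abel

lemma sub_two_mul_upSum_choose_one (p : Equiv.Perm (Fin n)) :
    (n - 2) * upSum (fun t => t.choose 1) p =
      3 * patternCount p123 p + 2 * patternCount p132 p + 2 * patternCount (revComp p132) p +
        patternCount p231 p + patternCount (revComp p231) p := by
  have h := sum_patternCount_mul_patternCount (k := 3) (by decide) (1 : Equiv.Perm (Fin 2)) p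
  have h123 : patternCount (1 : Equiv.Perm (Fin 2)) p123 = 3 := by decide
  have h132 : patternCount (1 : Equiv.Perm (Fin 2)) p132 = 2 := by decide
  have h213 : patternCount (1 : Equiv.Perm (Fin 2)) (revComp p132) = 2 := by decide
  have h231 : patternCount (1 : Equiv.Perm (Fin 2)) p231 = 1 := by decide
  have h312 : patternCount (1 : Equiv.Perm (Fin 2)) (revComp p231) = 1 := by decide
  have h321 : patternCount (1 : Equiv.Perm (Fin 2)) p321 = 0 := by decide
  rw [sum_perm_fin_three, h123, h132, h213, h231, h312, h321, patternCount_one,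
    Nat.choose_one_right] at h
  lia

end Patterns

section GeneratingTree

lemma mem_Av_p123 {n : ℕ} {p : Equiv.Perm (Fin n)} :
    p ∈ Av n p123 ↔ ∀ i j k, i < j → j < k → p i < p j → ¬ p j < p k := by
  simp only [Av, mem_filter, mem_univ, true_and, eq_empty_iff_forall_notMem, mem_occurrences,
    not_and]
  constructor
  · intro h i j k hij hjk hpij hpjk
    have hmono : StrictMono ![i, j, k] := by simp [hij, hjk]
    have hpmono : StrictMono (p ∘ ![i, j, k]) := by
      simp [StrictMono, Fin.forall_fin_succ, hpij, hpjk, hpij.trans hpjk]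
    have hp123 : StrictMono p123 := by decide
    exact h _ hmono fun a b => hpmono.lt_iff_lt.trans hp123.lt_iff_lt.symm
  · intro h s hs hocc
    exact h (s 0) (s 1) (s 2) (hs (by decide)) (hs (by decide)) ((hocc 0 1).mpr (by decide))
      ((hocc 1 2).mpr (by decide))

/-- The permutation of `Fin (n + 1)` whose first entry is smaller than exactly `s` of the others,
the others being in the same relative order as the entries of `p`. -/
def prepend {n : ℕ} (s : Fin (n + 1)) (p : Equiv.Perm (Fin n)) : Equiv.Perm (Fin (n + 1)) :=
  (finSuccEquiv n).trans (p.optionCongr.trans (finSuccEquiv' s.rev).symm)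

@[simp]
lemma prepend_apply_zero {n : ℕ} (s : Fin (n + 1)) (p : Equiv.Perm (Fin n)) :
    prepend s p 0 = s.rev := by
  simp [prepend]

@[simp]
lemma prepend_apply_succ {n : ℕ} (s : Fin (n + 1)) (p : Equiv.Perm (Fin n)) (i : Fin n) :
    prepend s p i.succ = s.rev.succAbove (p i) := by
  simp [prepend]

lemma prepend_bijective (n : ℕ) :
    Function.Bijective fun x : Fin (n + 1) × Equiv.Perm (Fin n) => prepend x.1 x.2 := by
  rw [Fintype.bijective_iff_injective_and_card]
  constructor
  · rintro ⟨s, p⟩ ⟨s', p'⟩ h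
    obtain rfl : s = s' := by simpa using congrArg (fun e => e 0) h
    obtain rfl : p = p' := Equiv.ext fun i => by simpa using congrArg (fun e => e i.succ) h
    rfl
  · simp [Fintype.card_perm, Nat.factorial_succ]

lemma sum_perm_succ {M : Type*} [AddCommMonoid M] {n : ℕ} (f : Equiv.Perm (Fin (n + 1)) → M) :
    ∑ p, f p = ∑ s, ∑ p, f (prepend s p) := by
  rw [← Fintype.sum_prod_type' (f := fun s p => f (prepend s p))]
  exact ((prepend_bijective n).sum_comp f).symm

/-- The 123-avoiding permutations of length `n` whose `t` largest entries are in decreasing order;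
these are the permutations to which an entry with `t` larger ones can be prepended. The condition is
expressed by saying that none of the `t` largest entries has a larger one to its right. -/
def topDecreasing (n t : ℕ) : Finset (Equiv.Perm (Fin n)) :=
  {p ∈ Av n p123 | t ≤ n ∧ ∀ i j, i < j → p i < p j → (p i : ℕ) + t < n}

lemma mem_topDecreasing {n t : ℕ} {p : Equiv.Perm (Fin n)} :
    p ∈ topDecreasing n t ↔ (∀ i j k, i < j → j < k → p i < p j → ¬ p j < p k) ∧ t ≤ n ∧
      ∀ i j, i < j → p i < p j → (p i : ℕ) + t < n := by
  rw [topDecreasing, mem_filter, mem_Av_p123]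

lemma topDecreasing_eq_empty {n t : ℕ} (h : n < t) : topDecreasing n t = ∅ :=
  filter_false_of_mem fun _ _ hp => hp.1.not_gt h

lemma topDecreasing_zero_right (n : ℕ) : topDecreasing n 0 = Av n p123 :=
  filter_true_of_mem fun p _ => ⟨n.zero_le, fun i _ _ _ => (p i).isLt⟩

lemma topDecreasing_succ_one (n : ℕ) : topDecreasing (n + 1) 1 = topDecreasing (n + 1) 0 := by
  ext p
  simp only [mem_topDecreasing]
  refine and_congr_right fun _ => ⟨fun _ => ⟨n.succ.zero_le, fun i _ _ _ => (p i).isLt⟩,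
    fun _ => ⟨by lia, fun i j _ hp => ?_⟩⟩
  have := (p j).isLt
  have := Fin.lt_def.mp hp
  lia

lemma prepend_zero_mem_topDecreasing {n t : ℕ} {p : Equiv.Perm (Fin n)} :
    prepend 0 p ∈ topDecreasing (n + 1) (t + 1) ↔ p ∈ topDecreasing n t := by
  simp [mem_topDecreasing, Fin.forall_fin_succ, Fin.le_last, ← add_assoc]

lemma prepend_succ_mem_topDecreasing {n t : ℕ} {s : Fin n} {p : Equiv.Perm (Fin n)} :
    prepend s.succ p ∈ topDecreasing (n + 1) (t + 1) ↔ p ∈ topDecreasing n (s + 1) ∧ t ≤ s := by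
  have hrev : (s.succ.rev : ℕ) + (s + 1) = n := by
    rw [Fin.val_rev, Fin.val_succ]
    lia
  have hlt (x : Fin n) : s.succ.rev < s.succ.rev.succAbove x ↔ n ≤ x + (s + 1) := by
    rw [Fin.lt_succAbove_iff_le_castSucc, Fin.le_def, Fin.val_castSucc]
    lia
  have hval (x : Fin n) (h : (x : ℕ) + (s + 1) < n) : (s.succ.rev.succAbove x : ℕ) = x := by
    rw [Fin.succAbove_of_castSucc_lt _ _ (by rw [Fin.lt_def, Fin.val_castSucc]; lia),
      Fin.val_castSucc]
  simp only [mem_topDecreasing, Fin.forall_fin_succ, prepend_apply_zero, prepend_apply_succ,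
    Fin.succ_lt_succ_iff, Fin.succAbove_lt_succAbove_iff, hlt, Fin.not_lt_zero,
    Fin.succ_pos, false_imp_iff, imp_true_iff, true_and, forall_true_left]
  constructor
  · rintro ⟨⟨hfirst, hav⟩, -, hpair, -⟩
    have := hpair (p.symm s.rev) (by rw [p.apply_symm_apply, Fin.val_rev]; lia)
    refine ⟨⟨hav, s.isLt, fun i j hij hp => ?_⟩, by lia⟩
    exact not_le.mp fun hle => hfirst i j hij hle hp
  · rintro ⟨⟨hav, -, htop⟩, hts⟩
    refine ⟨⟨fun i j hij hle hp => (htop i j hij hp).not_ge hle, hav⟩, by lia,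
      fun _ _ => by lia, fun i j hij hp => ?_⟩
    have := htop i j hij hp
    rw [hval _ this]
    lia

lemma sum_topDecreasing_succ {M : Type*} [AddCommMonoid M] (n t : ℕ)
    (f : Equiv.Perm (Fin (n + 1)) → M) :
    ∑ p ∈ topDecreasing (n + 1) (t + 1), f p =
      ∑ p ∈ topDecreasing n t, f (prepend 0 p) +
        ∑ s : Fin n, if t ≤ s then ∑ p ∈ topDecreasing n (s + 1), f (prepend s.succ p) else 0 := by
  have hsum {m : ℕ} (S : Finset (Equiv.Perm (Fin m))) (h : Equiv.Perm (Fin m) → M) :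
      ∑ p ∈ S, h p = ∑ p, if p ∈ S then h p else 0 := by simp
  rw [hsum, sum_perm_succ, Fin.sum_univ_succ, hsum (topDecreasing n t)]
  simp only [prepend_zero_mem_topDecreasing, prepend_succ_mem_topDecreasing]
  congr! 2 with s
  split_ifs with hts <;> simp [hts]

/-- Prepending an entry with exactly `t + 1` larger ones is possible for `topDecreasing n (t + 1)`
and leads to `topDecreasing (n + 1) (t + 1)` but not to `topDecreasing (n + 1) (t + 2)`. -/
lemma sum_topDecreasing_succ_succ {M : Type*} [AddCommMonoid M] {n : ℕ} {w : ℕ → M}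
    {f : Equiv.Perm (Fin (n + 1)) → M} {g : Equiv.Perm (Fin n) → M} (hw : w 0 = 0)
    (hfg : ∀ s p, f (prepend s p) = w s + g p) (t : ℕ) :
    ∑ p ∈ topDecreasing (n + 1) (t + 1), f p =
      ∑ p ∈ topDecreasing (n + 1) (t + 2), f p + ∑ p ∈ topDecreasing n t, g p +
        #(topDecreasing n (t + 1)) • w (t + 1) := by
  have hIco (u : ℕ) : ∑ p ∈ topDecreasing (n + 1) (u + 1), f p = ∑ p ∈ topDecreasing n u, g p +
      ∑ s ∈ Ico u n, ∑ p ∈ topDecreasing n (s + 1), (w (s + 1) + g p) := by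
    simp only [sum_topDecreasing_succ, hfg, Fin.val_zero, hw, zero_add, Fin.val_succ]
    rw [Fin.sum_univ_eq_sum_range
      (fun s => if u ≤ s then ∑ p ∈ topDecreasing n (s + 1), (w (s + 1) + g p) else 0) n,
      ← sum_filter, range_eq_Ico, Ico_filter_le, Nat.zero_max]
  rw [hIco, hIco]
  rcases lt_or_ge t n with ht | ht
  · rw [sum_eq_sum_Ico_succ_bot ht, sum_add_distrib, sum_const]
    abel
  · simp [Ico_eq_empty_of_le ht, Ico_eq_empty_of_le (ht.trans t.le_succ),
      topDecreasing_eq_empty (Nat.lt_succ_of_le ht)]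

@[simp]
lemma upCount_prepend_succ {n : ℕ} (s : Fin (n + 1)) (p : Equiv.Perm (Fin n)) (i : Fin n) :
    upCount (prepend s p) i.succ = upCount p i := by
  simp [upCount, Fin.card_filter_univ_succ, Fin.succAbove_lt_succAbove_iff]

@[simp]
lemma upCount_prepend_zero {n : ℕ} (s : Fin (n + 1)) (p : Equiv.Perm (Fin n)) :
    upCount (prepend s p) 0 = s := by
  have hfilter : ({j | 0 < j ∧ prepend s p 0 < prepend s p j} : Finset (Fin (n + 1))) =
      (Ioi s.rev).map (prepend s p).symm.toEmbedding := by
    ext j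
    cases j using Fin.cases <;> simp
  rw [upCount, hfilter, card_map, Fin.card_Ioi, Fin.val_rev]
  lia

lemma upSum_prepend {M : Type*} [AddCommMonoid M] {n : ℕ} (w : ℕ → M) (s : Fin (n + 1))
    (p : Equiv.Perm (Fin n)) : upSum w (prepend s p) = w s + upSum w p := by
  simp [upSum, Fin.sum_univ_succ]

end GeneratingTree

section GeneratingFunctions

open PowerSeries

variable {R : Type*} [CommRing R]

variable (R) in
/-- The generating function, over the length, of the sizes of the sets `topDecreasing n t`. -/
noncomputable def countSeries (t : ℕ) : R⟦X⟧ := PowerSeries.mk fun n => (#(topDecreasing n t) : R)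

/-- The generating function, over the length, of the sums of `upSum w` over the sets
`topDecreasing n t`. -/
noncomputable def upSumSeries (w : ℕ → R) (t : ℕ) : R⟦X⟧ :=
  PowerSeries.mk fun n => ∑ p ∈ topDecreasing n t, upSum w p

lemma countSeries_zero : countSeries R 0 = countSeries R 1 + 1 := by
  ext n
  rcases n with _ | n
  · have hone : topDecreasing 0 0 = {1} := by decide
    simp [countSeries, topDecreasing_eq_empty, hone]
  · simp [countSeries, topDecreasing_succ_one, coeff_one]

lemma countSeries_succ (t : ℕ) :
    countSeries R (t + 1) = countSeries R (t + 2) + X * countSeries R t := by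
  ext n
  rcases n with _ | n
  · simp [countSeries, topDecreasing_eq_empty]
  · rw [map_add, coeff_succ_X_mul]
    simpa [countSeries] using
      sum_topDecreasing_succ_succ (n := n) (w := 0) (f := fun _ => (1 : R)) (g := fun _ => 1)
        rfl (fun _ _ => by simp) t

lemma X_pow_dvd_countSeries (t : ℕ) : X ^ t ∣ countSeries R t :=
  X_pow_dvd_iff.mpr fun n hn => by simp [countSeries, topDecreasing_eq_empty hn]

lemma countSeries_eq (t : ℕ) :
    countSeries R t = castCatalanSeries R * (X * castCatalanSeries R) ^ t := by
  refine sub_eq_zero.mp (eq_zero_of_recurrence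
    (K := fun t => countSeries R t - castCatalanSeries R * (X * castCatalanSeries R) ^ t)
    ?_ (fun t => ?_) (fun t => ?_) t)
  · linear_combination countSeries_zero (R := R) - castCatalanSeries_eq_one_add (R := R)
  · rw [mul_pow, mul_left_comm]
    exact (X_pow_dvd_countSeries t).sub (dvd_mul_right _ _)
  · linear_combination countSeries_succ (R := R) t -
      X ^ (t + 1) * castCatalanSeries R ^ (t + 1) * castCatalanSeries_eq_one_add (R := R)

lemma card_Av_p123 (n : ℕ) : #(Av n p123) = catalan n := by
  simpa [countSeries, topDecreasing_zero_right] using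
    congrArg (coeff n) (countSeries_eq (R := ℤ) 0)

lemma upSumSeries_zero (w : ℕ → R) : upSumSeries w 0 = upSumSeries w 1 := by
  ext n
  rcases n with _ | n
  · simp [upSumSeries, upSum]
  · simp [upSumSeries, topDecreasing_succ_one]

lemma upSumSeries_succ {w : ℕ → R} (hw : w 0 = 0) (t : ℕ) :
    upSumSeries w (t + 1) = upSumSeries w (t + 2) + X * upSumSeries w t +
      C (w (t + 1)) * (X * countSeries R (t + 1)) := by
  ext n
  rcases n with _ | n
  · simp [upSumSeries, topDecreasing_eq_empty]
  · rw [map_add, map_add, coeff_succ_X_mul, coeff_C_mul, coeff_succ_X_mul, mul_comm (w _)]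
    simpa [upSumSeries, countSeries] using
      sum_topDecreasing_succ_succ (n := n) hw (upSum_prepend w) t

lemma X_pow_dvd_upSumSeries (w : ℕ → R) (t : ℕ) : X ^ t ∣ upSumSeries w t :=
  X_pow_dvd_iff.mpr fun n hn => by simp [upSumSeries, topDecreasing_eq_empty hn]

/-- Equivalently, the entries with `t ≠ 0` larger ones to their right have generating function
`(C - 1) ^ (t + 1)`, where `C - 1 = X * C ^ 2`. -/
lemma upSumSeries_zero_eq {w : ℕ → R} (hw : w 0 = 0) :
    upSumSeries w 0 = X * castCatalanSeries R ^ 2 *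
      (PowerSeries.mk w).subst (X * castCatalanSeries R ^ 2) := by
  set y : R⟦X⟧ := X * castCatalanSeries R ^ 2 with hy
  refine sub_eq_zero.mp (eq_zero_of_forall_X_pow_dvd fun N => ?_)
  have hres (t : ℕ) : castCatalanSeries R ^ (t + 2) *
      (upSumSeries w (t + 1) - upSumSeries w (t + 2) - X * upSumSeries w t) =
      y * (w (t + 1) • y ^ (t + 1)) := by
    rw [upSumSeries_succ hw, countSeries_eq, hy, smul_eq_C_mul]
    ring
  have hleft := X_pow_dvd_sub_sum_range (upSumSeries_zero w) (X_pow_dvd_upSumSeries w) N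
  simp only [hres, ← mul_sum] at hleft
  have hright := pow_dvd_subst_sub_sum_range (hasSubst_X_mul _ : HasSubst y) (PowerSeries.mk w)
    (N + 1)
  simp only [coeff_mk, sum_range_succ', hw, zero_smul, add_zero] at hright
  have hXy : X ^ N ∣ y ^ (N + 1) :=
    (pow_dvd_pow_of_dvd (dvd_mul_right X _) N).trans (pow_dvd_pow y N.le_succ)
  convert hleft.sub ((hXy.trans hright).mul_left y) using 1
  ring

lemma sum_upSum_choose_eq_coeff {m : ℕ} (hm : m ≠ 0) (n : ℕ) :
    ∑ p ∈ Av n p123, upSum (fun t => (t.choose m : R)) p =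
      coeff n ((X * castCatalanSeries R * centralBinomSeries R) ^ (m + 1)) := by
  have hzero : (Nat.choose 0 m : R) = 0 := by
    rw [Nat.choose_eq_zero_of_lt (Nat.pos_of_ne_zero hm), Nat.cast_zero]
  rw [← mul_subst_mk_choose, ← upSumSeries_zero_eq hzero, upSumSeries, coeff_mk,
    topDecreasing_zero_right]

lemma two_mul_X_mul_castCatalanSeries_mul_centralBinomSeries :
    2 * (X * castCatalanSeries R * centralBinomSeries R) = centralBinomSeries R - 1 := by
  linear_combination -centralBinomSeries_mul_one_sub (R := R)

lemma two_pow_mul_sum_upSum_choose {m : ℕ} (hm : m ≠ 0) (n : ℕ) :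
    2 ^ (m + 1) * ∑ p ∈ Av n p123, upSum (fun t => (t.choose m : R)) p =
      coeff n ((centralBinomSeries R - 1) ^ (m + 1)) := by
  rw [sum_upSum_choose_eq_coeff hm,
    ← two_mul_X_mul_castCatalanSeries_mul_centralBinomSeries, mul_pow 2,
    show (2 : R⟦X⟧) ^ (m + 1) = C (2 ^ (m + 1)) by rw [map_pow, map_ofNat], coeff_C_mul]

lemma four_mul_sum_upSum_choose_one {n : ℕ} (hn : n ≠ 0) :
    4 * ∑ p ∈ Av n p123, upSum (fun t => (t.choose 1 : R)) p = 4 ^ n - 2 * n.centralBinom := by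
  have h := two_pow_mul_sum_upSum_choose (R := R) one_ne_zero n
  rw [show (centralBinomSeries R - 1) ^ (1 + 1) =
      centralBinomSeries R ^ 2 - 2 • centralBinomSeries R + 1 by ring] at h
  simp only [map_add, map_sub, map_nsmul, coeff_centralBinomSeries_sq, coeff_centralBinomSeries,
    coeff_one, if_neg hn] at h
  linear_combination h

lemma eight_mul_sum_upSum_choose_two {n : ℕ} (hn : n ≠ 0) :
    8 * ∑ p ∈ Av n p123, upSum (fun t => (t.choose 2 : R)) p =
      (2 * n + 4) * n.centralBinom - 3 * 4 ^ n := by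
  have h := two_pow_mul_sum_upSum_choose (R := R) two_ne_zero n
  rw [show (centralBinomSeries R - 1) ^ (2 + 1) = centralBinomSeries R ^ 3 -
      3 • centralBinomSeries R ^ 2 + 3 • centralBinomSeries R - 1 by ring] at h
  simp only [map_add, map_sub, map_nsmul, coeff_centralBinomSeries_cube,
    coeff_centralBinomSeries_sq, coeff_centralBinomSeries, coeff_one, if_neg hn] at h
  linear_combination h

end GeneratingFunctions

section Totals

variable {n : ℕ}

lemma patternTotal_self {k : ℕ} (q : Equiv.Perm (Fin k)) : patternTotal q (Av n q) = 0 :=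
  sum_eq_zero fun _ hp => card_eq_zero.mpr (mem_filter.mp hp).2

lemma patternTotal_revComp_Av_p123 {k : ℕ} (q : Equiv.Perm (Fin k)) :
    patternTotal (revComp q) (Av n p123) = patternTotal q (Av n p123) := by
  have h : revComp p123 = p123 := by decide
  rw [← patternTotal_revComp q p123, h]

lemma patternTotal_p132_eq_sum :
    patternTotal p132 (Av n p123) = ∑ p ∈ Av n p123, upSum (fun t => t.choose 2) p := by
  simp only [← patternCount_p123_add_p132, sum_add_distrib]
  rw [← patternTotal, patternTotal_self, zero_add, patternTotal]

lemma sub_two_mul_sum_upSum_choose_one :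
    (n - 2) * ∑ p ∈ Av n p123, upSum (fun t => t.choose 1) p =
      4 * patternTotal p132 (Av n p123) + 2 * patternTotal p231 (Av n p123) := by
  simp only [mul_sum, sub_two_mul_upSum_choose_one, sum_add_distrib]
  simp only [← mul_sum, ← patternTotal.eq_1, patternTotal_self, patternTotal_revComp_Av_p123]
  ring

lemma choose_three_mul_catalan : n.choose 3 * catalan n =
    2 * patternTotal p132 (Av n p123) + 2 * patternTotal p231 (Av n p123) +
      patternTotal p321 (Av n p123) := by
  have h := sum_congr (rfl : Av n p123 = _) fun p _ => sum_patternCount 3 p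
  simp only [sum_perm_fin_three, sum_add_distrib, sum_const, smul_eq_mul, card_Av_p123] at h
  simp only [← patternTotal.eq_1, patternTotal_self, patternTotal_revComp_Av_p123] at h
  lia

lemma cast_patternTotal_p132 (hn : n ≠ 0) : (patternTotal p132 (Av n p123) : ℚ) =
    (n + 2) / 4 * n.centralBinom - 3 * 4 ^ n / 8 := by
  have h := eight_mul_sum_upSum_choose_two (R := ℚ) hn
  have hcast := congrArg (Nat.cast (R := ℚ)) (patternTotal_p132_eq_sum (n := n))
  simp only [upSum] at h hcast
  push_cast at hcast
  linear_combination hcast + h / 8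

lemma cast_patternTotal_p231 (hn : n ≠ 0) : (patternTotal p231 (Av n p123) : ℚ) =
    (n + 4) * 4 ^ n / 8 - (3 * n + 2) / 4 * n.centralBinom := by
  have h := four_mul_sum_upSum_choose_one (R := ℚ) hn
  have hcast := congrArg (Nat.cast (R := ℚ)) (sub_two_mul_sum_upSum_choose_one (n := n))
  have hsub : ((n - 2 : ℕ) : ℚ) * (4 ^ n - 2 * n.centralBinom) =
      (n - 2) * (4 ^ n - 2 * n.centralBinom) := by
    rcases Nat.lt_or_ge n 2 with hlt | hge
    · obtain rfl : n = 1 := by lia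
      norm_num [Nat.centralBinom]
    · rw [Nat.cast_sub hge, Nat.cast_ofNat]
  simp only [upSum] at h hcast
  push_cast at hcast
  linear_combination -hcast / 2 + ((n - 2 : ℕ) : ℚ) * h / 8 + hsub / 8 -
    2 * cast_patternTotal_p132 hn

lemma cast_choose_three (n : ℕ) : (n.choose 3 : ℚ) = n * (n - 1) * (n - 2) / 6 := by
  induction n with
  | zero => simp
  | succ n ih =>
    rw [Nat.choose_succ_succ' n 2, Nat.cast_add, ih, Nat.cast_choose_two]
    push_cast
    ring

lemma cast_catalan (n : ℕ) : (catalan n : ℚ) = n.centralBinom / (n + 1) := by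
  have h := congrArg (Nat.cast (R := ℚ)) (succ_mul_catalan_eq_centralBinom n)
  push_cast at h
  field_simp
  linear_combination h

lemma cast_patternTotal_p321 (hn : n ≠ 0) : (patternTotal p321 (Av n p123) : ℚ) =
    n * (n ^ 2 + 3 * n + 8) / (6 * (n + 1)) * n.centralBinom - (n + 1) * 4 ^ n / 4 := by
  have hcast := congrArg (Nat.cast (R := ℚ)) (choose_three_mul_catalan (n := n))
  push_cast [cast_choose_three, cast_catalan, cast_patternTotal_p132 hn,
    cast_patternTotal_p231 hn] at hcast
  rw [eq_sub_of_add_eq' hcast.symm]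
  field_simp
  ring

lemma cast_centralBinom_succ (n : ℕ) :
    ((n + 1).centralBinom : ℚ) = 2 * (2 * n + 1) / (n + 1) * n.centralBinom := by
  have h := congrArg (Nat.cast (R := ℚ)) n.succ_mul_centralBinom_succ
  push_cast at h
  field_simp
  linear_combination h

lemma binom_natCast (m k : ℕ) : binom m k = m.choose k := by
  simp [binom]

lemma binom_two (m : ℕ) : binom m 2 = m * (m - 1) / 2 := by
  rw [← Nat.cast_choose_two]
  exact binom_natCast m 2

lemma binom_two_mul_add_one (k : ℕ) : binom (2 * k + 1) k = (k + 1).centralBinom / 2 := by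
  have h : (k + 1).centralBinom = 2 * (2 * k + 1).choose k := by
    rw [Nat.centralBinom_eq_two_mul_choose, mul_add_one, Nat.choose_succ_succ',
      Nat.choose_symm_half, ← two_mul]
  rw [binom_natCast, h]
  push_cast
  ring

lemma binom_two_mul_add_one_sub_one (k : ℕ) :
    binom (2 * k + 1) ((k : ℤ) - 1) = k / (k + 2) * ((k + 1).centralBinom / 2) := by
  rw [← binom_two_mul_add_one]
  rcases k with _ | k
  · simp [binom]
  · have h := congrArg (Nat.cast (R := ℚ)) (Nat.choose_succ_right_eq (2 * (k + 1) + 1) k)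
    rw [show 2 * (k + 1) + 1 - k = k + 3 by lia] at h
    rw [Nat.cast_add_one, add_sub_cancel_right, ← Nat.cast_add_one, binom_natCast, binom_natCast]
    push_cast at h ⊢
    field_simp
    linear_combination -h

lemma binom_combination_p231 (hn : 2 ≤ n) :
    (2 * (n : ℚ) - 1) * binom (2 * n - 3) ((n : ℤ) - 2)
        - (2 * (n : ℚ) + 1) * binom (2 * n - 1) ((n : ℤ) - 1) =
      -(3 * n + 2) / 4 * n.centralBinom := by
  obtain ⟨m, rfl⟩ := Nat.exists_eq_add_of_le' hn
  have h₀ : binom (2 * (m + 2) - 3) ((m + 2 : ℕ) - 2 : ℤ) = (m + 1).centralBinom / 2 := by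
    rw [← binom_two_mul_add_one]
    push_cast
    congr 1
    ring
  have h₁ : binom (2 * (m + 2) - 1) ((m + 2 : ℕ) - 1 : ℤ) = (m + 2).centralBinom / 2 := by
    rw [← binom_two_mul_add_one]
    push_cast
    congr 1
    ring
  rw [h₀, h₁, cast_centralBinom_succ (m + 1)]
  push_cast
  field_simp
  ring

lemma binom_combination_p321 (hn : n ≠ 0) :
    1 / 6 * binom (2 * n + 5) ((n : ℤ) + 1) * binom (n + 4) 2
        - 5 / 3 * binom (2 * n + 3) n * binom (n + 3) 2
        + 17 / 3 * binom (2 * n + 1) ((n : ℤ) - 1) * binom (n + 2) 2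
        - 6 * binom (2 * n - 1) ((n : ℤ) - 2) * binom (n + 1) 2 =
      n * (n ^ 2 + 3 * n + 8) / (6 * (n + 1)) * n.centralBinom := by
  obtain ⟨m, rfl⟩ := Nat.exists_eq_succ_of_ne_zero hn
  have h₃ := binom_two_mul_add_one_sub_one (m + 3)
  have h₂ := binom_two_mul_add_one_sub_one (m + 2)
  have h₁ := binom_two_mul_add_one_sub_one (m + 1)
  have h₀ := binom_two_mul_add_one_sub_one m
  rw [show ((m + 3 : ℕ) : ℤ) - 1 = (m.succ : ℤ) + 1 by push_cast; ring] at h₃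
  rw [show ((m + 2 : ℕ) : ℤ) - 1 = m.succ by push_cast; ring] at h₂
  rw [show (m : ℤ) - 1 = (m.succ : ℤ) - 2 by push_cast; ring] at h₀
  rw [show 2 * m.succ + 5 = 2 * (m + 3) + 1 by lia, show 2 * m.succ + 3 = 2 * (m + 2) + 1 by lia,
    show 2 * m.succ - 1 = 2 * m + 1 by lia, h₀, h₁, h₂, h₃]
  simp only [binom_two, cast_centralBinom_succ (m + 3), cast_centralBinom_succ (m + 2),
    cast_centralBinom_succ (m + 1)]
  push_cast
  field_simp
  ring

lemma two_zpow_two_mul_sub_three (n : ℕ) : (2 : ℚ) ^ (2 * (n : ℤ) - 3) = 4 ^ n / 8 := by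
  rw [zpow_sub₀ two_ne_zero, zpow_mul, zpow_natCast]
  norm_num

lemma four_zpow_sub_one (n : ℕ) : (4 : ℚ) ^ ((n : ℤ) - 1) = 4 ^ n / 4 := by
  rw [zpow_sub_one₀ four_ne_zero, zpow_natCast, div_eq_mul_inv]

end Totals

end PatternTotals

open PatternTotals in
theorem mainTheorem6 :
    (∀ n : ℕ, 1 ≤ n →
      (patternTotal p132 (Av n p123) : ℚ) =
        ((n : ℚ) + 2) / 4 * binom (2 * n) n - 3 * (2 : ℚ) ^ (2 * (n : ℤ) - 3)) ∧
    (∀ n : ℕ, 2 ≤ n →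
      (patternTotal p231 (Av n p123) : ℚ) =
        (2 * (n : ℚ) - 1) * binom (2 * n - 3) ((n : ℤ) - 2)
          - (2 * (n : ℚ) + 1) * binom (2 * n - 1) ((n : ℤ) - 1)
          + ((n : ℚ) + 4) * (2 : ℚ) ^ (2 * (n : ℤ) - 3)) ∧
    (∀ n : ℕ, 1 ≤ n →
      (patternTotal p321 (Av n p123) : ℚ) =
        1 / 6 * binom (2 * n + 5) ((n : ℤ) + 1) * binom (n + 4) 2
          - 5 / 3 * binom (2 * n + 3) n * binom (n + 3) 2
          + 17 / 3 * binom (2 * n + 1) ((n : ℤ) - 1) * binom (n + 2) 2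
          - 6 * binom (2 * n - 1) ((n : ℤ) - 2) * binom (n + 1) 2
          - ((n : ℚ) + 1) * (4 : ℚ) ^ ((n : ℤ) - 1)) := by
  refine ⟨fun n hn => ?_, fun n hn => ?_, fun n hn => ?_⟩
  · rw [cast_patternTotal_p132 (Nat.ne_zero_of_lt hn), binom_natCast,
      ← Nat.centralBinom_eq_two_mul_choose, two_zpow_two_mul_sub_three, mul_div_assoc]
  · rw [cast_patternTotal_p231 (Nat.ne_zero_of_lt hn), binom_combination_p231 hn,
      two_zpow_two_mul_sub_three]
    ring
  · rw [cast_patternTotal_p321 (Nat.ne_zero_of_lt hn),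
      binom_combination_p321 (Nat.ne_zero_of_lt hn), four_zpow_sub_one, mul_div_assoc (_ + 1)]
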